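/- Let $H$ be a complex Hilbert space with orthonormal basis $\{\varphi_n\}_{n=1}^\infty$, let $\mu>0$, $2<p\le\infty$, $t_n=n^{-\mu}$, and put $$\mathcal W^T=\Big\{\sum_{n=1}^\infty t_nc_n\varphi_n\;:\;c_n\in\mathbb C,\ \sum_{n=1}^\infty|c_n|^2\le 1\Big\}.$$ For $\varepsilon>0$ suppose that the Fourier coefficients $x_n=\langle x,\varphi_n\rangle$ of $x=\sum_n x_n\varphi_n\in H$ are known with an $\ell_p$-error at most $\varepsilon$, i.e. the information about $x$ is $$\mathcal I_{\varepsilon,p}x=\{(x_n+e_n)_{n\ge1}\;:\;e\in\ell_p,\ \|e\|_{\ell_p}\le\varepsilon\}\subset\ell_p ,$$ and let the error of optimal recovery be $$\mathcal E(\mathcal W^T,\mathcal I_{\varepsilon,p})=\inf_{\Phi}\ \sup_{x\in\mathcal W^T}\ \sup_{a\in\mathcal I_{\varepsilon,p}x}\|x-\Phi(a)\|_H ,$$ where the infimum is over all mappings $\Phi:\ell_p\to H$. Then $$\lim_{\varepsilon\to0^+}\varepsilon^{-\lambda}\,\mathcal E(\mathcal W^T,\mathcal I_{\varepsilon,p})=\Big(\frac{\alpha+\beta}{\beta}\Big)^{1/2}\Big(\frac{\beta^{1/2}}{\alpha^{1/p}}\Big)^{\lambda},\qquad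 \lambda=\frac{\mu}{\mu+1/2-1/p},$$ where, with the Euler beta function $B$, $$\alpha=\frac1{2\mu}B\Big(\frac{2p-2}{p-2},\frac1{2\mu}\Big),\qquad \beta=\frac1{2\mu}B\Big(\frac{p}{p-2},1+\frac1{2\mu}\Big).$$ For $p=\infty$ one reads $1/p=0$, $\frac{2p-2}{p-2}=2$ and $\frac{p}{p-2}=1$. -/

import Mathlib

open scoped ENNReal Topology

noncomputable section

namespace OptimalRecovery

/-- The error of the method of recovery `Φ : Z → Y` of the operator `A` on the class `W`,
given the (set-valued) information `I`:
`sup_{x ∈ W} sup_{z ∈ I x} ‖A x - Φ z‖`, as an extended non-negative number. -/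
def methodError {X Y Z : Type*} [NormedAddCommGroup Y]
    (A : X → Y) (W : Set X) (I : X → Set Z) (Φ : Z → Y) : ℝ≥0∞ :=
  ⨆ x ∈ W, ⨆ z ∈ I x, ‖A x - Φ z‖ₑ

/-- The error of optimal recovery: the infimum of the error over all mappings `Φ : Z → Y`. -/
def optimalError {X Y Z : Type*} [NormedAddCommGroup Y]
    (A : X → Y) (W : Set X) (I : X → Set Z) : ℝ≥0∞ :=
  ⨅ Φ : Z → Y, methodError A W I Φ

variable {H : Type*} [NormedAddCommGroup H] [InnerProductSpace ℂ H]

/-- The class of all `x = ∑ₙ tₙ cₙ φₙ` with `∑ₙ |cₙ|² ≤ 1`. -/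
def hilbertClass (φ : HilbertBasis ℕ ℂ H) (t : ℕ → ℝ) : Set H :=
  {x | ∃ c : ℕ → ℂ, Summable (fun n => ‖c n‖ ^ 2) ∧ ∑' n, ‖c n‖ ^ 2 ≤ 1 ∧
    HasSum (fun n => ((t n : ℂ) * c n) • φ n) x}

/-- The information `x ↦ (x₁, x₂, …) + B[ε, ℓ_p]`, where `xₙ` are the Fourier coefficients of `x`
with respect to the basis `φ` and `B[ε, ℓ_p]` is the closed ball of radius `ε` centred at zero. -/
def coeffInfo (φ : HilbertBasis ℕ ℂ H) (p : ℝ≥0∞) (ε : ℝ) (x : H) :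
    Set (lp (fun _ : ℕ => ℂ) p) :=
  {a | ∃ e : lp (fun _ : ℕ => ℂ) p, ‖e‖ ≤ ε ∧ ∀ n, a n = φ.repr x n + e n}

/-- The sequence `n ^ (-μ)`, `n = 1, 2, …`, indexed from zero. -/
def powerSeq (μ : ℝ) (n : ℕ) : ℝ := ((n : ℝ) + 1) ^ (-μ)

/-- The real number `1 / p`, which is `0` for `p = ∞`. -/
def recip (p : ℝ≥0∞) : ℝ := (p⁻¹).toReal

/-- The exponent `μ / (μ + 1/2 - 1/p)`. -/
def rate (μ : ℝ) (p : ℝ≥0∞) : ℝ := μ / (μ + 1 / 2 - recip p)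

/-- `α = (1/(2μ)) B((2p-2)/(p-2), 1/(2μ))`, where `(2p-2)/(p-2) = (2-2/p)/(1-2/p)`
is `2` for `p = ∞`. -/
def alphaConst (μ : ℝ) (p : ℝ≥0∞) : ℝ :=
  1 / (2 * μ) *
    ProbabilityTheory.beta ((2 - 2 * recip p) / (1 - 2 * recip p)) (1 / (2 * μ))

/-- `β = (1/(2μ)) B(p/(p-2), 1 + 1/(2μ))`, where `p/(p-2) = 1/(1-2/p)` is `1` for `p = ∞`. -/
def betaConst (μ : ℝ) (p : ℝ≥0∞) : ℝ :=
  1 / (2 * μ) *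
    ProbabilityTheory.beta (1 / (1 - 2 * recip p)) (1 + 1 / (2 * μ))

end OptimalRecovery

end

open scoped ENNReal Topology

namespace OptimalRecovery

open MeasureTheory Set

/-! ### The truncated power profile. -/

/-- The profile `x ↦ (1 - x ^ (2μ)) ^ s` on `[0, 1)`, extended by zero. -/
noncomputable def truncPow (μ s x : ℝ) : ℝ := if x < 1 then (1 - x ^ (2 * μ)) ^ s else 0

lemma truncPow_of_lt (μ s : ℝ) {x : ℝ} (hx : x < 1) :
    truncPow μ s x = (1 - x ^ (2 * μ)) ^ s := if_pos hx

lemma truncPow_of_ge (μ s : ℝ) {x : ℝ} (hx : 1 ≤ x) : truncPow μ s x = 0 :=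
  if_neg hx.not_gt

lemma one_sub_rpow_pos {μ x : ℝ} (hμ : 0 < μ) (hx0 : 0 ≤ x) (hx : x < 1) :
    0 < 1 - x ^ (2 * μ) :=
  sub_pos.2 (Real.rpow_lt_one hx0 hx (by positivity))

lemma truncPow_nonneg {μ x : ℝ} (hμ : 0 < μ) (s : ℝ) (hx0 : 0 ≤ x) : 0 ≤ truncPow μ s x := by
  unfold truncPow
  split_ifs with h
  · exact Real.rpow_nonneg (one_sub_rpow_pos hμ hx0 h).le _
  · exact le_rfl

lemma truncPow_le_one {μ s x : ℝ} (hμ : 0 < μ) (hs : 0 ≤ s) (hx0 : 0 ≤ x) :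
    truncPow μ s x ≤ 1 := by
  unfold truncPow
  split_ifs with h
  · exact Real.rpow_le_one (one_sub_rpow_pos hμ hx0 h).le
      (by linarith [Real.rpow_nonneg hx0 (2 * μ)]) hs
  · exact zero_le_one

lemma truncPow_antitoneOn {μ s : ℝ} (hμ : 0 < μ) (hs : 0 ≤ s) :
    AntitoneOn (truncPow μ s) (Ici 0) := by
  intro x hx y hy hxy
  rw [mem_Ici] at hx hy
  rcases lt_or_ge y 1 with h | h
  · rw [truncPow_of_lt _ _ h, truncPow_of_lt _ _ (hxy.trans_lt h)]
    have := one_sub_rpow_pos hμ hy h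
    gcongr
  · rw [truncPow_of_ge _ _ h]
    exact truncPow_nonneg hμ s hx

lemma truncPow_rpow {μ x : ℝ} (hμ : 0 < μ) {s t : ℝ} (ht : 0 < t) (hx0 : 0 ≤ x) :
    truncPow μ s x ^ t = truncPow μ (s * t) x := by
  rcases lt_or_ge x 1 with h | h
  · rw [truncPow_of_lt _ _ h, truncPow_of_lt _ _ h,
      Real.rpow_mul (one_sub_rpow_pos hμ hx0 h).le]
  · rw [truncPow_of_ge _ _ h, truncPow_of_ge _ _ h, Real.zero_rpow ht.ne']

lemma rpow_mul_truncPow {μ x : ℝ} (hμ : 0 < μ) (s : ℝ) (hx0 : 0 ≤ x) :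
    x ^ (2 * μ) * truncPow μ s x = truncPow μ s x - truncPow μ (s + 1) x := by
  rcases lt_or_ge x 1 with h | h
  · rw [truncPow_of_lt _ _ h, truncPow_of_lt _ _ h,
      Real.rpow_add_one (one_sub_rpow_pos hμ hx0 h).ne']
    ring
  · simp [truncPow_of_ge _ _ h]

lemma one_sub_truncPow_one_le {μ x : ℝ} (hμ : 0 < μ) :
    1 - truncPow μ 1 x ≤ x ^ (2 * μ) := by
  rcases lt_or_ge x 1 with h | h
  · rw [truncPow_of_lt _ _ h, Real.rpow_one]; linarith
  · rw [truncPow_of_ge _ _ h, sub_zero]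
    exact Real.one_le_rpow h (by positivity)

/-! ### Beta integrals and Riemann sums of the profile. -/

lemma beta_eq_integral {u v : ℝ} (hu : 0 < u) (hv : 0 < v) :
    ProbabilityTheory.beta u v = ∫ x in (0 : ℝ)..1, x ^ (u - 1) * (1 - x) ^ (v - 1) := by
  rw [ProbabilityTheory.beta_eq_betaIntegralReal u v hu hv, Complex.betaIntegral]
  rw [← Complex.ofReal_re (∫ x in (0 : ℝ)..1, x ^ (u - 1) * (1 - x) ^ (v - 1)),
    ← intervalIntegral.integral_ofReal]
  congr 1
  refine intervalIntegral.integral_congr fun x hx => ?_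
  rw [uIcc_of_le zero_le_one] at hx
  simp only [Complex.ofReal_mul]
  rw [Complex.ofReal_cpow hx.1, Complex.ofReal_cpow (by linarith [hx.2])]
  push_cast
  rfl

lemma beta_comm (u v : ℝ) : ProbabilityTheory.beta u v = ProbabilityTheory.beta v u := by
  simp only [ProbabilityTheory.beta, add_comm u v, mul_comm (Real.Gamma u)]

lemma beta_add_one_add_beta_add_one {u v : ℝ} (hu : 0 < u) (hv : 0 < v) :
    ProbabilityTheory.beta (u + 1) v + ProbabilityTheory.beta u (v + 1) =
      ProbabilityTheory.beta u v := by
  have h := (Real.Gamma_pos_of_pos (add_pos hu hv)).ne'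
  have h' := (add_pos hu hv).ne'
  simp only [ProbabilityTheory.beta]
  rw [show u + 1 + v = u + v + 1 by ring, show u + (v + 1) = u + v + 1 by ring,
    Real.Gamma_add_one hu.ne', Real.Gamma_add_one hv.ne', Real.Gamma_add_one h']
  field_simp

/-- The substitution `x = y^(1/(2μ))` turns the profile into `(1-y)^s` on `(0,1)`. -/
lemma integral_truncPow {μ s : ℝ} (hμ : 0 < μ) (hs : 0 ≤ s) :
    ∫ x in Ioi 0, truncPow μ s x =
      1 / (2 * μ) * ProbabilityTheory.beta (s + 1) (1 / (2 * μ)) := by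
  have hc : 0 < 1 / (2 * μ) := by positivity
  rw [← integral_comp_rpow_Ioi_of_pos hc, beta_comm, beta_eq_integral hc (by linarith),
    ← intervalIntegral.integral_const_mul, intervalIntegral.integral_of_le zero_le_one,
    integral_Ioc_eq_integral_Ioo]
  refine (setIntegral_eq_of_subset_of_forall_sdiff_eq_zero (s := Ioo 0 1) measurableSet_Ioi
    (fun x hx => hx.1) fun x hx => ?_).trans
    (setIntegral_congr_fun measurableSet_Ioo fun x hx => ?_)
  · have h1 : 1 ≤ x := by
      by_contra h
      exact hx.2 ⟨hx.1, not_le.1 h⟩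
    rw [truncPow_of_ge _ _ (Real.one_le_rpow h1 hc.le), smul_zero]
  · simp only [smul_eq_mul]
    rw [truncPow_of_lt _ _ (Real.rpow_lt_one hx.1.le hx.2 hc), ← Real.rpow_mul hx.1.le,
      one_div_mul_cancel (by positivity), Real.rpow_one, add_sub_cancel_right]
    ring

lemma integral_truncPow_comp_mul {μ s h : ℝ} (hh : 0 < h) {N : ℕ}
    (hN : 1 ≤ h * N) :
    h * ∫ x in (0 : ℝ)..N, truncPow μ s (h * x) = ∫ x in Ioi 0, truncPow μ s x := by
  rw [intervalIntegral.integral_comp_mul_left _ hh.ne', smul_eq_mul, mul_zero,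
    mul_inv_cancel_left₀ hh.ne', intervalIntegral.integral_of_le (by linarith)]
  symm
  refine setIntegral_eq_of_subset_of_forall_sdiff_eq_zero measurableSet_Ioi
    (fun x hx => hx.1) fun x hx => truncPow_of_ge _ _ ?_
  by_contra h1
  exact hx.2 ⟨hx.1, by linarith⟩

lemma truncPow_comp_mul_antitoneOn {μ s h : ℝ} (hμ : 0 < μ) (hs : 0 ≤ s) (hh : 0 < h) (N : ℕ) :
    AntitoneOn (fun x => truncPow μ s (h * x)) (Icc (0 : ℝ) (0 + N)) := fun _ hx _ hy hxy =>
  truncPow_antitoneOn hμ hs (mem_Ici.2 (mul_nonneg hh.le hx.1)) (mem_Ici.2 (mul_nonneg hh.le hy.1))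
    (mul_le_mul_of_nonneg_left hxy hh.le)

lemma mul_sum_truncPow_le {μ s h : ℝ} (hμ : 0 < μ) (hs : 0 ≤ s) (hh : 0 < h) {N : ℕ}
    (hN : 1 ≤ h * N) :
    h * ∑ i ∈ Finset.range N, truncPow μ s (h * (i + 1)) ≤ ∫ x in Ioi 0, truncPow μ s x := by
  rw [← integral_truncPow_comp_mul hh hN]
  have := (truncPow_comp_mul_antitoneOn hμ hs hh N).sum_le_integral
  simp only [zero_add, Nat.cast_add, Nat.cast_one] at this
  gcongr

/-- Left-endpoint sums dominate the integral of a decreasing function; passing to right endpoints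
loses at most the value at `0`, which is at most `1`. -/
lemma le_mul_sum_truncPow {μ s h : ℝ} (hμ : 0 < μ) (hs : 0 ≤ s) (hh : 0 < h) {N : ℕ}
    (hN : 1 ≤ h * N) :
    (∫ x in Ioi 0, truncPow μ s x) - h ≤
      h * ∑ i ∈ Finset.range N, truncPow μ s (h * (i + 1)) := by
  rw [← integral_truncPow_comp_mul hh hN, sub_le_iff_le_add, ← mul_add_one]
  have h1 := (truncPow_comp_mul_antitoneOn hμ hs hh N).integral_le_sum
  have h2 := Finset.sum_range_succ (fun i : ℕ => truncPow μ s (h * i)) N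
  rw [Finset.sum_range_succ'] at h2
  have h3 := truncPow_nonneg hμ s (mul_nonneg hh.le (Nat.cast_nonneg N))
  have h4 := truncPow_le_one (x := h * (0 : ℕ)) hμ hs (by simp)
  simp only [zero_add, Nat.cast_add, Nat.cast_one] at h1 h2
  gcongr
  linarith

/-! ### Hölder and norm estimates in `ℓ_p`. -/

lemma recip_nonneg (p : ℝ≥0∞) : 0 ≤ recip p := ENNReal.toReal_nonneg

lemma recip_top : recip ∞ = 0 := by simp [recip]

lemma recip_eq_inv (p : ℝ≥0∞) : recip p = p.toReal⁻¹ := ENNReal.toReal_inv p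

lemma two_lt_toReal {p : ℝ≥0∞} (hp : 2 < p) (hp' : p ≠ ∞) : 2 < p.toReal := by
  simpa using (ENNReal.toReal_lt_toReal (by simp) hp').2 hp

lemma two_mul_recip_lt_one {p : ℝ≥0∞} (hp : 2 < p) : 2 * recip p < 1 := by
  rcases eq_or_ne p ∞ with rfl | hp'
  · simp [recip_top]
  · have h := two_lt_toReal hp hp'
    rw [recip_eq_inv, ← div_eq_mul_inv, div_lt_one (by linarith)]
    exact h

/-- Hölder's inequality with the exponents `1 / (1 - 2 / p)` and `p / 2`. -/
lemma sum_mul_norm_sq_le {p : ℝ≥0∞} (hp : 2 < p) (e : lp (fun _ : ℕ => ℂ) p) {ε : ℝ}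
    (he : ‖e‖ ≤ ε) (m : ℕ → ℝ) (hm : ∀ n, 0 ≤ m n) (s : Finset ℕ) :
    ∑ n ∈ s, m n * ‖e n‖ ^ 2 ≤
      ε ^ 2 * (∑ n ∈ s, m n ^ (1 / (1 - 2 * recip p))) ^ (1 - 2 * recip p) := by
  have hε : 0 ≤ ε := (lp.norm_nonneg' e).trans he
  rcases eq_or_ne p ∞ with rfl | hp'
  · simp only [recip_top, mul_zero, sub_zero, div_one, Real.rpow_one, Finset.mul_sum]
    refine Finset.sum_le_sum fun n _ => ?_
    rw [mul_comm]
    have := (lp.norm_apply_le_norm ENNReal.top_ne_zero e n).trans he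
    have := hm n
    gcongr
  · have hP := two_lt_toReal hp hp'
    have hr := two_mul_recip_lt_one hp
    have hc : Real.HolderConjugate (1 / (1 - 2 * recip p)) (p.toReal / 2) := by
      rw [Real.holderConjugate_iff]
      constructor
      · rw [lt_div_iff₀ (by linarith)]
        have : 0 < recip p := by rw [recip_eq_inv]; positivity
        linarith
      · rw [recip_eq_inv]; simp; ring
    refine (Real.inner_le_Lp_mul_Lq_of_nonneg s hc (fun n _ => hm n)
      (fun n _ => by positivity)).trans ?_
    rw [one_div_one_div, mul_comm]
    refine mul_le_mul_of_nonneg_right ?_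
      (Real.rpow_nonneg (Finset.sum_nonneg fun n _ => Real.rpow_nonneg (hm n) _) _)
    have h1 : ∀ n, (‖e n‖ ^ 2) ^ (p.toReal / 2) = ‖e n‖ ^ p.toReal := fun n => by
      rw [← Real.rpow_natCast, ← Real.rpow_mul (norm_nonneg _)]
      congr 1
      push_cast
      ring
    simp only [h1]
    calc (∑ n ∈ s, ‖e n‖ ^ p.toReal) ^ (1 / (p.toReal / 2))
        ≤ (ε ^ p.toReal) ^ (1 / (p.toReal / 2)) := by
          have := (lp.sum_rpow_le_norm_rpow (by linarith) e s).trans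
            (Real.rpow_le_rpow (lp.norm_nonneg' e) he (by linarith))
          gcongr
      _ = ε ^ 2 := by
          rw [← Real.rpow_mul hε, ← Real.rpow_natCast]
          congr 1
          push_cast
          field_simp

/-- Certifies that the extremal sequence is admissible noise. For `p = ∞` the factor `S^(2/p)` is
`1` and `g ≤ 1` suffices; otherwise raise to the power `p/2` and sum. -/
lemma lp_norm_le_of_norm_sq_le {p : ℝ≥0∞} (hp : 2 < p) (f : lp (fun _ : ℕ => ℂ) p)
    {ε S : ℝ} (hε : 0 ≤ ε) (hS : 0 < S) (g : ℕ → ℝ) (hg0 : ∀ n, 0 ≤ g n) (hg1 : ∀ n, g n ≤ 1)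
    (hf : ∀ n, ‖f n‖ ^ 2 ≤ ε ^ 2 / S ^ (2 * recip p) * g n)
    (hsum : p ≠ ∞ → ∀ s : Finset ℕ, ∑ n ∈ s, g n ^ (p.toReal / 2) ≤ S) : ‖f‖ ≤ ε := by
  rcases eq_or_ne p ∞ with rfl | hp'
  · refine lp.norm_le_of_forall_le hε fun n => ?_
    have h := hf n
    rw [recip_top, mul_zero, Real.rpow_zero, div_one] at h
    refine abs_le_of_sq_le_sq' (h.trans (mul_le_of_le_one_right (sq_nonneg _) (hg1 n))) hε |>.2
  · have hP := two_lt_toReal hp hp'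
    refine lp.norm_le_of_forall_sum_le (by linarith) hε fun s => ?_
    have h1 : ∀ n, ‖f n‖ ^ p.toReal ≤ ε ^ p.toReal / S * g n ^ (p.toReal / 2) := fun n => by
      calc ‖f n‖ ^ p.toReal = (‖f n‖ ^ 2) ^ (p.toReal / 2) := by
            rw [← Real.rpow_natCast, ← Real.rpow_mul (norm_nonneg _)]
            congr 1
            push_cast
            ring
        _ ≤ (ε ^ 2 / S ^ (2 * recip p) * g n) ^ (p.toReal / 2) := by
            gcongr
            exact hf n
        _ = ε ^ p.toReal / S * g n ^ (p.toReal / 2) := by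
            rw [Real.mul_rpow (by positivity) (hg0 n), Real.div_rpow (by positivity) (by positivity),
              ← Real.rpow_natCast, ← Real.rpow_mul hε, ← Real.rpow_mul hS.le, recip_eq_inv]
            have e1 : ((2 : ℕ) : ℝ) * (p.toReal / 2) = p.toReal := by push_cast; ring
            have e2 : 2 * p.toReal⁻¹ * (p.toReal / 2) = 1 := by field_simp
            rw [e1, e2, Real.rpow_one]
    calc ∑ n ∈ s, ‖f n‖ ^ p.toReal ≤ ∑ n ∈ s, ε ^ p.toReal / S * g n ^ (p.toReal / 2) :=
          Finset.sum_le_sum fun n _ => h1 n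
      _ = ε ^ p.toReal / S * ∑ n ∈ s, g n ^ (p.toReal / 2) := by rw [Finset.mul_sum]
      _ ≤ ε ^ p.toReal / S * S := by
          have := hsum hp' s
          gcongr
      _ = ε ^ p.toReal := by field_simp

/-! ### General upper and lower bounds for recovery. -/

variable {H : Type*} [NormedAddCommGroup H] [InnerProductSpace ℂ H]

lemma hasSum_norm_sq_repr (φ : HilbertBasis ℕ ℂ H) (y : H) :
    HasSum (fun n => ‖φ.repr y n‖ ^ 2) (‖y‖ ^ 2) := by
  have := lp.hasSum_norm (by simp) (φ.repr y)
  simpa using this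

lemma repr_eq_of_hasSum (φ : HilbertBasis ℕ ℂ H) {b : ℕ → ℂ} {x : H}
    (hx : HasSum (fun n => b n • φ n) x) (k : ℕ) : φ.repr x k = b k := by
  rw [φ.repr_apply_apply]
  refine (hx.mapL (innerSL ℂ (φ k))).unique ?_
  have h : ∀ n, innerSL ℂ (φ k) (b n • φ n) = if n = k then b k else 0 := fun n => by
    rw [innerSL_apply_apply, inner_smul_right, orthonormal_iff_ite.1 φ.orthonormal k n]
    by_cases hn : n = k
    · simp [hn]
    · simp [hn, Ne.symm hn]
  simp only [h]
  exact hasSum_ite_eq k (b k)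

/-- The error is `(1-m)x - me`, so this is convexity of the square with weights `1-m` and `m`. -/
lemma norm_sub_sq_le {m : ℝ} (hm0 : 0 ≤ m) (hm1 : m ≤ 1) (x e : ℂ) :
    ‖x - m * (x + e)‖ ^ 2 ≤ (1 - m) * ‖x‖ ^ 2 + m * ‖e‖ ^ 2 := by
  have h1 : ‖x - m * (x + e)‖ ≤ (1 - m) * ‖x‖ + m * ‖e‖ := by
    have : x - m * (x + e) = ((1 - m : ℝ) : ℂ) * x - (m : ℂ) * e := by push_cast; ring
    rw [this]
    refine (norm_sub_le _ _).trans ?_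
    rw [norm_mul, norm_mul, Complex.norm_of_nonneg (by linarith), Complex.norm_of_nonneg hm0]
  have h2 : ((1 - m) * ‖x‖ + m * ‖e‖) ^ 2 ≤ (1 - m) * ‖x‖ ^ 2 + m * ‖e‖ ^ 2 := by
    nlinarith [mul_nonneg (mul_nonneg hm0 (sub_nonneg.2 hm1)) (sq_nonneg (‖x‖ - ‖e‖))]
  exact (pow_le_pow_left₀ (norm_nonneg _) h1 2).trans h2

/-- The error of the method `a ↦ ∑_{n < N} mₙ aₙ φₙ`. -/
lemma norm_sub_sum_sq_le (φ : HilbertBasis ℕ ℂ H) {p : ℝ≥0∞} (hp : 2 < p) {t m : ℕ → ℝ} {L ε : ℝ}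
    {N : ℕ} (hm0 : ∀ n, 0 ≤ m n) (hm1 : ∀ n, m n ≤ 1) (hmN : ∀ n, N ≤ n → m n = 0)
    (hL : ∀ n, (1 - m n) * t n ^ 2 ≤ L) {x : H} (hx : x ∈ hilbertClass φ t)
    {a : lp (fun _ : ℕ => ℂ) p} (ha : a ∈ coeffInfo φ p ε x) :
    ‖x - ∑ n ∈ Finset.range N, ((m n : ℂ) * a n) • φ n‖ ^ 2 ≤
      L + ε ^ 2 *
        (∑ n ∈ Finset.range N, m n ^ (1 / (1 - 2 * recip p))) ^ (1 - 2 * recip p) := by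
  obtain ⟨c, hc, hc1, hcx⟩ := hx
  obtain ⟨e, he, hae⟩ := ha
  have hL0 : 0 ≤ L := (mul_nonneg (sub_nonneg.2 (hm1 0)) (sq_nonneg _)).trans (hL 0)
  have hxn := repr_eq_of_hasSum φ hcx
  set z := ∑ n ∈ Finset.range N, ((m n : ℂ) * a n) • φ n
  have hz : ∀ n, φ.repr z n = m n * a n := by
    refine repr_eq_of_hasSum φ (hasSum_sum_of_ne_finset_zero fun n hn => ?_)
    rw [hmN n (by simpa using hn)]
    simp
  have hterm : ∀ n, ‖φ.repr (x - z) n‖ ^ 2 ≤ L * ‖c n‖ ^ 2 + m n * ‖e n‖ ^ 2 := fun n => by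
    rw [map_sub, lp.coeFn_sub, Pi.sub_apply, hz, hae]
    refine (norm_sub_sq_le (hm0 n) (hm1 n) _ _).trans (add_le_add_left ?_ _)
    rw [hxn, norm_mul, mul_pow, Complex.norm_real, Real.norm_eq_abs, sq_abs, ← mul_assoc]
    exact mul_le_mul_of_nonneg_right (hL n) (sq_nonneg _)
  have hs : HasSum (fun n => m n * ‖e n‖ ^ 2) (∑ n ∈ Finset.range N, m n * ‖e n‖ ^ 2) :=
    hasSum_sum_of_ne_finset_zero fun n hn => by
      rw [hmN n (by simpa using hn), zero_mul]
  refine (hasSum_le hterm (hasSum_norm_sq_repr φ (x - z))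
    ((hc.hasSum.mul_left L).add hs)).trans ?_
  exact add_le_add (mul_le_of_le_one_right hL0 hc1) (sum_mul_norm_sq_le hp e he m hm0 _)

/-- A method gives the same output for `x` and `-x`, and these are `2‖x‖` apart. -/
lemma enorm_le_optimalError {Z : Type*} {W : Set H} {I : H → Set Z} {x : H} {z : Z} (hx : x ∈ W)
    (hx' : -x ∈ W) (hz : z ∈ I x) (hz' : z ∈ I (-x)) :
    ‖x‖ₑ ≤ optimalError (id : H → H) W I := by
  refine le_iInf fun Φ => ?_
  have key : ∀ y ∈ W, z ∈ I y → ‖y - Φ z‖ₑ ≤ methodError id W I Φ := fun y hy hzy =>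
    (le_iSup₂_of_le (f := fun w (_ : w ∈ I y) => ‖y - Φ w‖ₑ) z hzy le_rfl).trans
      (le_iSup₂_of_le (f := fun v (_ : v ∈ W) => ⨆ w ∈ I v, ‖id v - Φ w‖ₑ) y hy le_rfl)
  have h : ‖x‖ ≤ max ‖x - Φ z‖ ‖-x - Φ z‖ := by
    have h1 : (2 : ℝ) * ‖x‖ ≤ ‖x - Φ z‖ + ‖-x - Φ z‖ := by
      have := norm_sub_le (x - Φ z) (-x - Φ z)
      rwa [show x - Φ z - (-x - Φ z) = x + x by abel, ← two_smul ℝ x, norm_smul,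
        Real.norm_ofNat] at this
    linarith [le_max_left ‖x - Φ z‖ ‖-x - Φ z‖, le_max_right ‖x - Φ z‖ ‖-x - Φ z‖]
  rcases le_max_iff.1 h with h | h
  · exact (enorm_le_iff_norm_le.2 h).trans (key x hx hz)
  · exact (enorm_le_iff_norm_le.2 h).trans (key (-x) hx' hz')

lemma ofReal_sqrt_le_optimalError (φ : HilbertBasis ℕ ℂ H) {p : ℝ≥0∞} {t b : ℕ → ℝ} {ε : ℝ}
    {N : ℕ} (ht : ∀ n, t n ≠ 0) (hbN : ∀ n, N ≤ n → b n = 0)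
    (hb : ∑ n ∈ Finset.range N, (b n / t n) ^ 2 ≤ 1)
    (hε : ∀ f : lp (fun _ : ℕ => ℂ) p, (∀ n, f n = b n) → ‖f‖ ≤ ε) :
    ENNReal.ofReal √(∑ n ∈ Finset.range N, b n ^ 2) ≤
      optimalError (id : H → H) (hilbertClass φ t) (coeffInfo φ p ε) := by
  set x : H := ∑ n ∈ Finset.range N, (b n : ℂ) • φ n with hxdef
  have hsum : HasSum (fun n => (b n : ℂ) • φ n) x :=
    hasSum_sum_of_ne_finset_zero fun n hn => by
      rw [hbN n (by simpa using hn)]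
      simp
  have hrepr := repr_eq_of_hasSum φ hsum
  have hnorm : ‖x‖ = √(∑ n ∈ Finset.range N, b n ^ 2) := by
    rw [← Real.sqrt_sq (norm_nonneg x)]
    congr 1
    refine (hasSum_norm_sq_repr φ x).unique ?_
    simp only [hrepr, Complex.norm_real, Real.norm_eq_abs, sq_abs]
    exact hasSum_sum_of_ne_finset_zero fun n hn => by
      rw [hbN n (by simpa using hn)]
      simp
  have hmem : Memℓp (fun n => (b n : ℂ)) p := by
    refine Memℓp.of_exponent_ge (memℓp_zero ?_) zero_le
    refine (Finset.range N).finite_toSet.subset fun n hn => ?_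
    by_contra h
    exact hn (by rw [hbN n (by simpa using h)]; simp)
  set f : lp (fun _ : ℕ => ℂ) p := ⟨_, hmem⟩
  have hf : ∀ n, f n = b n := fun _ => rfl
  have hfn := hε f hf
  have hcs : HasSum (fun n => ‖((b n / t n : ℝ) : ℂ)‖ ^ 2)
      (∑ n ∈ Finset.range N, (b n / t n) ^ 2) := by
    simp only [Complex.norm_real, Real.norm_eq_abs, sq_abs]
    exact hasSum_sum_of_ne_finset_zero fun n hn => by
      rw [hbN n (by simpa using hn)]
      simp
  have hxW : x ∈ hilbertClass φ t := by
    refine ⟨fun n => ((b n / t n : ℝ) : ℂ), hcs.summable, hcs.tsum_eq.trans_le hb, ?_⟩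
    convert hsum using 3 with n
    rw [← Complex.ofReal_mul, mul_div_cancel₀ _ (ht n)]
  have hxW' : -x ∈ hilbertClass φ t := by
    obtain ⟨c, h1, h2, h3⟩ := hxW
    refine ⟨fun n => -c n, by simpa using h1, by simpa using h2, ?_⟩
    simpa using h3.neg
  rw [← hnorm, ofReal_norm]
  refine enorm_le_optimalError (z := (0 : lp (fun _ : ℕ => ℂ) p)) hxW hxW' ?_ ?_
  -- Noise `∓f` cancels the coefficients of `±x`, leaving the data `0`.
  · exact ⟨-f, by rwa [lp.norm_neg], fun n => by simp [hrepr, hf]⟩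
  · exact ⟨f, hfn, fun n => by simp [hrepr, hf]⟩

/-! ### The constants as integrals, and estimates at a fixed scale. -/

lemma alphaConst_eq_integral {μ : ℝ} (hμ : 0 < μ) {p : ℝ≥0∞} (hp : 2 < p) :
    alphaConst μ p = ∫ x in Ioi 0, truncPow μ (1 / (1 - 2 * recip p)) x := by
  have h := sub_pos.2 (two_mul_recip_lt_one hp)
  rw [integral_truncPow hμ (by positivity), alphaConst]
  congr 2
  field_simp
  ring

/-- Uses `B(u+1,v) + B(u,v+1) = B(u,v)` with `u = q`, `v = 1/(2μ)`. -/
lemma alphaConst_add_betaConst_eq_integral {μ : ℝ} (hμ : 0 < μ) {p : ℝ≥0∞} (hp : 2 < p) :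
    alphaConst μ p + betaConst μ p =
      ∫ x in Ioi 0, truncPow μ (1 / (1 - 2 * recip p) - 1) x := by
  have h := sub_pos.2 (two_mul_recip_lt_one hp)
  have hr := recip_nonneg p
  rw [integral_truncPow hμ (by rw [sub_nonneg, one_le_div h]; linarith), sub_add_cancel,
    ← beta_add_one_add_beta_add_one (by positivity) (by positivity), alphaConst, betaConst,
    mul_add, add_comm 1 (1 / (2 * μ))]
  congr 3
  field_simp
  ring

lemma alphaConst_pos {μ : ℝ} (hμ : 0 < μ) {p : ℝ≥0∞} (hp : 2 < p) : 0 < alphaConst μ p := by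
  have h := sub_pos.2 (two_mul_recip_lt_one hp)
  have h' : 0 < 2 - 2 * recip p := by linarith
  exact mul_pos (by positivity) (ProbabilityTheory.beta_pos (by positivity) (by positivity))

lemma betaConst_pos {μ : ℝ} (hμ : 0 < μ) {p : ℝ≥0∞} (hp : 2 < p) : 0 < betaConst μ p := by
  have h := sub_pos.2 (two_mul_recip_lt_one hp)
  exact mul_pos (by positivity) (ProbabilityTheory.beta_pos (by positivity) (by positivity))

lemma exists_nat_one_le_mul {h : ℝ} (hh : 0 < h) : ∃ N : ℕ, 1 ≤ h * N := by
  obtain ⟨N, hN⟩ := exists_nat_ge (1 / h)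
  exact ⟨N, by rwa [div_le_iff₀' hh] at hN⟩

lemma one_le_mul_add_one {h : ℝ} (hh : 0 < h) {N n : ℕ} (hN : 1 ≤ h * N) (hn : N ≤ n) :
    1 ≤ h * ((n : ℝ) + 1) := by
  refine hN.trans (mul_le_mul_of_nonneg_left ?_ hh.le)
  have : (N : ℝ) ≤ n := by exact_mod_cast hn
  linarith

lemma powerSeq_pos (μ : ℝ) (n : ℕ) : 0 < powerSeq μ n := Real.rpow_pos_of_pos (by positivity) _

lemma mul_rpow_mul_powerSeq_sq {μ h : ℝ} (hh : 0 < h) (n : ℕ) :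
    (h * ((n : ℝ) + 1)) ^ (2 * μ) * powerSeq μ n ^ 2 = h ^ (2 * μ) := by
  have hn : (0 : ℝ) < (n : ℝ) + 1 := by positivity
  rw [powerSeq, ← Real.rpow_natCast, ← Real.rpow_mul hn.le, Real.mul_rpow hh.le hn.le, mul_assoc,
    ← Real.rpow_add hn]
  have : 2 * μ + -μ * ((2 : ℕ) : ℝ) = 0 := by push_cast; ring
  rw [this, Real.rpow_zero, mul_one]

lemma optimalError_le (φ : HilbertBasis ℕ ℂ H) {μ : ℝ} (hμ : 0 < μ) {p : ℝ≥0∞} (hp : 2 < p)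
    {ε h : ℝ} (hh : 0 < h) (hεh : ε ^ 2 = h ^ (2 * μ + 1 - 2 * recip p) *
      alphaConst μ p ^ (2 * recip p) / betaConst μ p) :
    optimalError (id : H → H) (hilbertClass φ (powerSeq μ)) (coeffInfo φ p ε) ≤
      ENNReal.ofReal √(h ^ (2 * μ) * ((alphaConst μ p + betaConst μ p) / betaConst μ p)) := by
  obtain ⟨N, hN⟩ := exists_nat_one_le_mul hh
  have hr := sub_pos.2 (two_mul_recip_lt_one hp)
  have hα := alphaConst_pos hμ hp
  have hβ := betaConst_pos hμ hp
  have hnn : ∀ n : ℕ, 0 ≤ h * ((n : ℝ) + 1) := fun n => by positivity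
  set m : ℕ → ℝ := fun n => truncPow μ 1 (h * (n + 1)) with hm
  have hm0 : ∀ n, 0 ≤ m n := fun n => truncPow_nonneg hμ 1 (hnn n)
  refine iInf_le_of_le (fun a => ∑ n ∈ Finset.range N, ((m n : ℂ) * a n) • φ n)
    (iSup₂_le fun x hx => iSup₂_le fun a ha => ?_)
  rw [← ofReal_norm]
  refine ENNReal.ofReal_le_ofReal (Real.le_sqrt_of_sq_le ?_)
  refine (norm_sub_sum_sq_le φ hp (L := h ^ (2 * μ)) hm0
    (fun n => truncPow_le_one hμ zero_le_one (hnn n))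
    (fun n hn => truncPow_of_ge _ _ (one_le_mul_add_one hh hN hn)) (fun n => ?_) hx ha).trans ?_
  · rw [← mul_rpow_mul_powerSeq_sq hh n]
    exact mul_le_mul_of_nonneg_right (one_sub_truncPow_one_le hμ) (sq_nonneg _)
  · have hS : ∑ n ∈ Finset.range N, m n ^ (1 / (1 - 2 * recip p)) ≤ alphaConst μ p / h := by
      rw [le_div_iff₀' hh, alphaConst_eq_integral hμ hp]
      refine le_of_eq_of_le ?_ (mul_sum_truncPow_le hμ (by positivity) hh hN)
      congr 1
      refine Finset.sum_congr rfl fun n _ => ?_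
      rw [hm, truncPow_rpow hμ (by positivity) (hnn n), one_mul]
    have hS0 : 0 ≤ ∑ n ∈ Finset.range N, m n ^ (1 / (1 - 2 * recip p)) :=
      Finset.sum_nonneg fun n _ => Real.rpow_nonneg (hm0 n) _
    calc _ ≤ h ^ (2 * μ) + ε ^ 2 * (alphaConst μ p / h) ^ (1 - 2 * recip p) := by gcongr
      _ = _ := by
        rw [hεh, Real.div_rpow hα.le hh.le, add_sub_assoc, Real.rpow_add hh,
          Real.rpow_sub hα, Real.rpow_one]
        have h1 : 0 < h ^ (1 - 2 * recip p) := by positivity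
        have h2 : 0 < alphaConst μ p ^ (2 * recip p) := by positivity
        field_simp
        ring

lemma le_optimalError (φ : HilbertBasis ℕ ℂ H) {μ : ℝ} (hμ : 0 < μ) {p : ℝ≥0∞} (hp : 2 < p)
    {ε h : ℝ} (hε : 0 ≤ ε) (hh : 0 < h) (hεh : ε ^ 2 = h ^ (2 * μ + 1 - 2 * recip p) *
      alphaConst μ p ^ (2 * recip p) / betaConst μ p) :
    ENNReal.ofReal √(h ^ (2 * μ) *
        ((alphaConst μ p + betaConst μ p - h) / (betaConst μ p + h))) ≤
      optimalError (id : H → H) (hilbertClass φ (powerSeq μ)) (coeffInfo φ p ε) := by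
  obtain ⟨N, hN⟩ := exists_nat_one_le_mul hh
  have hr0 := recip_nonneg p
  have hr := sub_pos.2 (two_mul_recip_lt_one hp)
  have hα := alphaConst_pos hμ hp
  have hβ := betaConst_pos hμ hp
  have hq : 0 ≤ 1 / (1 - 2 * recip p) - 1 := by rw [sub_nonneg, one_le_div hr]; linarith
  have hnn : ∀ n : ℕ, 0 ≤ h * ((n : ℝ) + 1) := fun n => by positivity
  -- For `p = ∞` the exponent is `0` and the profile is the indicator of `[0,1)`, which is why the
  -- cutoff is explicit.
  set g : ℕ → ℝ := fun n => truncPow μ (1 / (1 - 2 * recip p) - 1) (h * (n + 1)) with hg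
  -- The extra `h` in the denominator absorbs the Riemann sum error, keeping the element in the
  -- class.
  set A : ℝ := h ^ (2 * μ) * h / (betaConst μ p + h) with hA
  have hA0 : 0 ≤ A := by positivity
  have hg0 : ∀ n, 0 ≤ g n := fun n => truncPow_nonneg hμ _ (hnn n)
  have hg1 : ∀ n, g n ≤ 1 := fun n => truncPow_le_one hμ hq (hnn n)
  have hgN : ∀ n, N ≤ n → g n = 0 := fun n hn =>
    truncPow_of_ge _ _ (one_le_mul_add_one hh hN hn)
  have hsq : ∀ n, √(A * g n) ^ 2 = A * g n := fun n => Real.sq_sqrt (mul_nonneg hA0 (hg0 n))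
  have hlow : alphaConst μ p + betaConst μ p - h ≤ h * ∑ n ∈ Finset.range N, g n := by
    rw [alphaConst_add_betaConst_eq_integral hμ hp]
    exact le_mul_sum_truncPow hμ hq hh hN
  have hupp : h * ∑ n ∈ Finset.range N, g n ≤ alphaConst μ p + betaConst μ p := by
    rw [alphaConst_add_betaConst_eq_integral hμ hp]
    exact mul_sum_truncPow_le hμ hq hh hN
  have hlow' : alphaConst μ p - h ≤
      h * ∑ n ∈ Finset.range N, truncPow μ (1 / (1 - 2 * recip p)) (h * (n + 1)) := by
    rw [alphaConst_eq_integral hμ hp]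
    exact le_mul_sum_truncPow hμ (by positivity) hh hN
  refine le_trans (ENNReal.ofReal_le_ofReal (Real.sqrt_le_sqrt ?_))
    (ofReal_sqrt_le_optimalError φ (b := fun n => √(A * g n)) (N := N)
      (fun n => (powerSeq_pos μ n).ne') (fun n hn => ?_) ?_ fun f hf => ?_)
  · simp only [hsq, ← Finset.mul_sum]
    calc _ ≤ h ^ (2 * μ) * ((h * ∑ n ∈ Finset.range N, g n) / (betaConst μ p + h)) := by gcongr
      _ = _ := by rw [hA]; ring
  · simp [hgN n hn]
  · have hterm : ∀ n : ℕ, (√(A * g n) / powerSeq μ n) ^ 2 = h / (betaConst μ p + h) *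
        (g n - truncPow μ (1 / (1 - 2 * recip p)) (h * (n + 1))) := fun n => by
      have h1 := rpow_mul_truncPow hμ (1 / (1 - 2 * recip p) - 1) (hnn n)
      rw [sub_add_cancel] at h1
      change _ * g n = g n - _ at h1
      have h2 := (powerSeq_pos μ n).ne'
      rw [← h1, div_pow, hsq, hA, ← mul_rpow_mul_powerSeq_sq hh n]
      field_simp
    simp only [hterm, ← Finset.mul_sum, Finset.sum_sub_distrib]
    rw [div_mul_eq_mul_div, div_le_one (by positivity)]
    linarith
  · refine lp_norm_le_of_norm_sq_le hp f hε (div_pos hα hh) g hg0 hg1 (fun n => ?_)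
      fun hp' s => ?_
    · rw [hf, Complex.norm_real, Real.norm_eq_abs, sq_abs, hsq]
      refine mul_le_mul_of_nonneg_right ?_ (hg0 n)
      calc A ≤ h ^ (2 * μ) * h / betaConst μ p := by rw [hA]; gcongr; linarith
        _ = _ := by
          rw [hεh, Real.div_rpow hα.le hh.le, Real.rpow_sub hh, Real.rpow_add hh, Real.rpow_one]
          have h1 : 0 < h ^ (2 * recip p) := by positivity
          have h2 : 0 < alphaConst μ p ^ (2 * recip p) := by positivity
          field_simp
    · have hP := two_lt_toReal hp hp'
      -- Equality case of Hölder: `(q-1)p/2 = q`.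
      have hexp : (1 / (1 - 2 * recip p) - 1) * (p.toReal / 2) = 1 / (1 - 2 * recip p) := by
        have h1 : recip p * p.toReal = 1 := by
          rw [recip_eq_inv]; exact inv_mul_cancel₀ (by linarith)
        field_simp
        linear_combination 2 * h1
      have hgr : ∀ n, g n ^ (p.toReal / 2) =
          truncPow μ (1 / (1 - 2 * recip p)) (h * (n + 1)) := fun n => by
        rw [hg, truncPow_rpow hμ (by linarith) (hnn n), hexp]
      -- Enlarge the range so that it contains `s` and still reaches the end of the support.
      obtain ⟨M, hM⟩ := s.exists_nat_subset_range
      have hMN : 1 ≤ h * (max M N : ℕ) := hN.trans (by gcongr; exact le_max_right _ _)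
      rw [le_div_iff₀' hh, alphaConst_eq_integral hμ hp]
      refine le_trans ?_ (mul_sum_truncPow_le hμ (by positivity) hh hMN)
      simp only [hgr]
      refine mul_le_mul_of_nonneg_left (Finset.sum_le_sum_of_subset_of_nonneg
        (hM.trans (Finset.range_mono (le_max_left _ _)))
        fun n _ _ => truncPow_nonneg hμ _ (hnn n)) hh.le

end OptimalRecovery

/-! ### Passage to the limit. -/

theorem mainTheorem12 {H : Type*} [NormedAddCommGroup H] [InnerProductSpace ℂ H]
    [CompleteSpace H] (φ : HilbertBasis ℕ ℂ H) (μ : ℝ) (hμ : 0 < μ)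
    (p : ℝ≥0∞) (hp : 2 < p) :
    Filter.Tendsto
      (fun ε : ℝ => ENNReal.ofReal (ε ^ (-OptimalRecovery.rate μ p)) *
        OptimalRecovery.optimalError (id : H → H)
          (OptimalRecovery.hilbertClass φ (OptimalRecovery.powerSeq μ))
          (OptimalRecovery.coeffInfo φ p ε))
      (𝓝[>] (0 : ℝ))
      (𝓝 (ENNReal.ofReal
        (((OptimalRecovery.alphaConst μ p + OptimalRecovery.betaConst μ p) /
            OptimalRecovery.betaConst μ p) ^ ((1 : ℝ) / 2) *
          (OptimalRecovery.betaConst μ p ^ ((1 : ℝ) / 2) /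
            OptimalRecovery.alphaConst μ p ^ OptimalRecovery.recip p) ^
              OptimalRecovery.rate μ p))) := by
  have hr := sub_pos.2 (OptimalRecovery.two_mul_recip_lt_one hp)
  have hα := OptimalRecovery.alphaConst_pos hμ hp
  have hβ := OptimalRecovery.betaConst_pos hμ hp
  set α := OptimalRecovery.alphaConst μ p with hαdef
  set β := OptimalRecovery.betaConst μ p with hβdef
  set r := OptimalRecovery.recip p with hrdef
  have hrate : OptimalRecovery.rate μ p = μ / (μ + 1 / 2 - r) := rfl
  set l := OptimalRecovery.rate μ p with hl
  have hden : 0 < μ + 1 / 2 - r := by linarith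
  have hl0 : 0 < l := by rw [hrate]; positivity
  set K := β ^ ((1 : ℝ) / 2) / α ^ r with hK
  have hK0 : 0 < K := by positivity
  have hK2 : K ^ 2 = β / α ^ (2 * r) := by
    rw [hK, div_pow, ← Real.sqrt_eq_rpow, Real.sq_sqrt hβ.le, mul_comm 2 r, Real.rpow_mul hα.le]
    norm_cast
  -- Solves the scale equation: `l/μ = 1/(μ+1/2-r)` and `K² = β/α^(2r)`.
  set h : ℝ → ℝ := fun ε => (ε * K) ^ (l / μ) with hh
  have hh0 : ∀ ε, 0 < ε → 0 < h ε := fun ε hε => by positivity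
  have hhlim : Filter.Tendsto h (𝓝[>] 0) (𝓝 0) := by
    have h1 : Continuous h := (continuous_id.mul continuous_const).rpow_const
      fun _ => Or.inr (by positivity)
    have h2 : h 0 = 0 := by
      simp only [hh, zero_mul]
      exact Real.zero_rpow (by positivity)
    exact (h2 ▸ h1.tendsto 0).mono_left nhdsWithin_le_nhds
  have hεh : ∀ ε, 0 < ε → ε ^ 2 = h ε ^ (2 * μ + 1 - 2 * r) * α ^ (2 * r) / β := by
    intro ε hε
    rw [hh, ← Real.rpow_mul (by positivity)]
    have h1 : l / μ * (2 * μ + 1 - 2 * r) = (2 : ℕ) := by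
      rw [hrate, show 2 * μ + 1 - 2 * r = (μ + 1 / 2 - r) * (2 : ℕ) by push_cast; ring]
      generalize μ + 1 / 2 - r = d at hden
      field_simp
    rw [h1, Real.rpow_natCast, mul_pow, hK2]
    have : 0 < α ^ (2 * r) := by positivity
    field_simp
  -- Here `h^μ = (εK)^l`, so the powers of `ε` cancel exactly; the upper bound becomes constant in
  -- `ε`.
  have hscale : ∀ ε, 0 < ε → ∀ x,
      ENNReal.ofReal (ε ^ (-l)) * ENNReal.ofReal √(h ε ^ (2 * μ) * x) =
        ENNReal.ofReal (√x * K ^ l) := by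
    intro ε hε x
    have hεl : 0 < ε ^ l := by positivity
    have h1 : h ε ^ (2 * μ) = (ε ^ l * K ^ l) ^ 2 := by
      rw [← Real.mul_rpow hε.le hK0.le, hh, ← Real.rpow_mul (by positivity), ← Real.rpow_natCast,
        ← Real.rpow_mul (by positivity)]
      congr 1
      push_cast
      field_simp
    rw [← ENNReal.ofReal_mul (by positivity), h1, Real.sqrt_mul (sq_nonneg _),
      Real.sqrt_sq (by positivity), Real.rpow_neg hε.le]
    congr 1
    field_simp
  have hlim : Filter.Tendsto (fun ε => ENNReal.ofReal (√((α + β - h ε) / (β + h ε)) * K ^ l))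
      (𝓝[>] 0) (𝓝 (ENNReal.ofReal (((α + β) / β) ^ ((1 : ℝ) / 2) * K ^ l))) := by
    refine ENNReal.tendsto_ofReal (Filter.Tendsto.mul_const _ ?_)
    rw [← Real.sqrt_eq_rpow]
    refine Filter.Tendsto.sqrt ?_
    have := (hhlim.const_sub (α + β)).div (hhlim.const_add β) (by simpa using hβ.ne')
    simp only [sub_zero, add_zero] at this
    exact this
  refine tendsto_of_tendsto_of_tendsto_of_le_of_le' hlim tendsto_const_nhds ?_ ?_
  · filter_upwards [self_mem_nhdsWithin] with ε hε
    rw [← hscale ε hε]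
    gcongr
    exact OptimalRecovery.le_optimalError φ hμ hp (le_of_lt hε) (hh0 ε hε) (hεh ε hε)
  · filter_upwards [self_mem_nhdsWithin] with ε hε
    rw [← Real.sqrt_eq_rpow, ← hscale ε hε]
    gcongr
    exact OptimalRecovery.optimalError_le φ hμ hp (hh0 ε hε) (hεh ε hε)
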